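/- Let $X_1,X_2,\dots$ be a strictly stationary sequence of real random variables with continuous marginal distribution function $F(x)=\mathbb P(X_1\le x)$, and let $M_n=\max_{1\le j\le n}X_j$. Suppose that there are constants $b>0$ and $B>0$ with $$F(x+u)-F(x)\le B\,u^{b}\qquad\text{for all }x\in\mathbb R,\ u>0 .$$ For $s\ge 1$ let $\mathcal M^s$ be the set of non-constant measurable functions $f:\mathbb R^s\to[-1,1]$, and for $g\in\mathcal M^t$ let $$\operatorname{Lip} g=\sup_{x\ne y}\frac{|g(y)-g(x)|}{|y_1-x_1|+\dots+|y_t-x_t|}\in(0,\infty].$$ For $r\in\mathbb N$ let $$\theta(r)=\sup\frac{\bigl|\operatorname{Cov}\bigl(f(X_{i_1},\dots,X_{i_s}),\,g(X_{j_1},\dots,X_{j_t})\bigr)\bigr|}{t\,\operatorname{Lip} g}\in[0,\infty],$$ where the supremum is over all $s,t\ge1$, all $f\in\mathcal M^s$, $g\in\mathcal M^t$ (the quotient being $0$ if $\operatorname{Lip} g=\infty$), and all indices $i_1\le\dots\le i_s\le j_1\le\dots\le j_t$ with $j_1-i_s\ge r$. Suppose that the sequence is $\theta$-weakly dependent, that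 is, $\theta(r)\to0$ as $r\to\infty$, and that $$\theta(r)=O(r^{-\beta})\ \text{ as } r\to\infty,\qquad\text{for some }\ \beta>\frac{1+\sqrt5}{2}\Bigl(1+\frac1b\Bigr).$$ Then $(X_j)$ admits a continuous phantom distribution function: there is a continuous distribution function $G$ on $\mathbb R$ (non-decreasing, with $\lim_{x\to-\infty}G(x)=0$ and $\lim_{x\to\infty}G(x)=1$) such that $$\sup_{u\in\mathbb R}\bigl|\mathbb P(M_n\le u)-G(u)^n\bigr|\longrightarrow0\qquad\text{as }n\to\infty .$$ -/

import Mathlib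

open MeasureTheory ProbabilityTheory Filter Topology Asymptotics
open scoped ENNReal

noncomputable section

namespace Phantom

variable {Ω : Type*} [MeasurableSpace Ω]

/-- Strict stationarity: every shift of the sequence has the same law, as a random element of
`ℕ → ℝ`, as the sequence itself. A sequence is indexed from `0`, so that `X j` is the `(j + 1)`-st
term `X_{j+1}` of a sequence `X_1, X_2, …`. -/
def IsStationary (P : Measure Ω) (X : ℕ → Ω → ℝ) : Prop :=
  ∀ k : ℕ, IdentDistrib (fun ω j => X (j + k) ω) (fun ω j => X j ω) P P

/-- The marginal distribution function `F(x) = P(X_1 ≤ x)`. -/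
def marginalDF (P : Measure Ω) (X : ℕ → Ω → ℝ) (x : ℝ) : ℝ :=
  P.real {ω | X 0 ω ≤ x}

/-- The partial maximum `M_n`, the largest of the first `n` terms, for `n ≥ 1`
(the value at `n = 0` is irrelevant). -/
def partialMax (X : ℕ → Ω → ℝ) (n : ℕ) (ω : Ω) : ℝ :=
  ⨆ j : Fin n, X j ω

/-- `G` is the distribution function of a probability measure on the real line. -/
structure IsDistributionFunction (G : ℝ → ℝ) : Prop where
  mono : Monotone G
  right_continuous : ∀ x, ContinuousWithinAt G (Set.Ici x) x
  tendsto_atBot : Tendsto G atBot (𝓝 0)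
  tendsto_atTop : Tendsto G atTop (𝓝 1)

/-- `G` is a phantom distribution function of the sequence `X`:
`sup_u |P(M_n ≤ u) - G(u)^n| → 0`. -/
def IsPhantomDF (P : Measure Ω) (X : ℕ → Ω → ℝ) (G : ℝ → ℝ) : Prop :=
  IsDistributionFunction G ∧
    Tendsto (fun n : ℕ => ⨆ u : ℝ, |P.real {ω | partialMax X n ω ≤ u} - G u ^ n|) atTop (𝓝 0)

/-- The class of measurable non-constant functions on `ℝ^s` that are bounded by `1`. -/
def testClass (s : ℕ) : Set ((Fin s → ℝ) → ℝ) :=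
  {f | Measurable f ∧ (∀ x, |f x| ≤ 1) ∧ ∃ x y, f x ≠ f y}

/-- The Lipschitz coefficient in `[0, ∞]` of a function on `ℝ^t`, with respect to the
`ℓ¹`-distance. -/
def lipCoeff {t : ℕ} (g : (Fin t → ℝ) → ℝ) : ℝ≥0∞ :=
  ⨆ (x : Fin t → ℝ) (y : Fin t → ℝ) (_ : y ≠ x),
    ENNReal.ofReal |g y - g x| / ENNReal.ofReal (∑ k, |y k - x k|)

/-- The coefficient `θ(r) ∈ [0, ∞]`: the supremum of
`|Cov(f(X_{i_1}, …, X_{i_s}), g(X_{j_1}, …, X_{j_t}))| / (t · Lip g)` over all `s, t ≥ 1`, all `f`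
and `g` in the test classes, and all `i_1 ≤ … ≤ i_s ≤ j_1 ≤ … ≤ j_t` with `j_1 - i_s ≥ r`.
For `Lip g = ∞` the quotient is `0`. -/
def thetaCoeff (P : Measure Ω) (X : ℕ → Ω → ℝ) (r : ℕ) : ℝ≥0∞ :=
  ⨆ (s : ℕ) (t : ℕ) (_ : 1 ≤ s) (_ : 1 ≤ t)
    (f : (Fin s → ℝ) → ℝ) (_ : f ∈ testClass s)
    (g : (Fin t → ℝ) → ℝ) (_ : g ∈ testClass t)
    (i : Fin s → ℕ) (_ : Monotone i) (j : Fin t → ℕ) (_ : Monotone j)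
    (_ : ∀ a b, i a + r ≤ j b),
    ENNReal.ofReal |cov[fun ω => f (fun a => X (i a) ω), fun ω => g (fun b => X (j b) ω); P]|
      / (t * lipCoeff g)

/-- `θ`-weak dependence: `θ(r) → 0`. -/
def IsThetaWeaklyDependent (P : Measure Ω) (X : ℕ → Ω → ℝ) : Prop :=
  Tendsto (thetaCoeff P X) atTop (𝓝 0)

end Phantom

end

/-! Fix a level `u` and put `a n = P(M_n ≤ u)`. Smoothing the indicator of a block of length `q` to
a function with Lipschitz coefficient `1 / ε`, and optimising `ε` against the concentration bound on
`F`, turns `θ`-dependence into near-multiplicativity of `a` across a gap `r`, with error `C * q * r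
^ (-κ)`, `κ = β * b / (1 + b)`, and `C` independent of `u`. The hypothesis on `β` gives `κ > 1`. The
rest concerns such sequences only and is uniform over them, hence in `u`.

Let `m` be the place where `a` crosses `exp (-1)`. Since `κ > 1`, there are gaps `r = o(m)` with `m
* r ^ (-κ) → 0`, and deleting such a gap costs little, for otherwise many separated blocks would
push `a m` below `exp (-1)`. So `a (p + q) ≈ a p * a q` on the scale `m`, which forces `a n ≈ exp
(-n / m)` (`eventually_abs_sub_exp_le`). Bounded `m` is harmless, as everything then decays
geometrically; if there is no crossing, `a` is identically `1`.

Thus `exp (-1 / m(u))` would be a phantom distribution function, but `m(u)` is integer valued. It is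
replaced by `softCount`, which is continuous in `u` (`continuous_softCount`) and asymptotic to `m`
(`eventually_le_softCount`, `softCount_le`). The uniform comparison is
`exists_forall_abs_sub_expNegInv_pow_le`. -/

namespace Phantom

/-- A sequence `a 0 = 1 ≥ a 1 ≥ a 2 ≥ … ≥ 0` that is multiplicative, `a (p + r + q) ≈ a p * a q`,
up to an error that is polynomially small in the gap `r` and up to the loss `1 - a r`. -/
structure IsGapMultiplicative (C κ : ℝ) (r₀ : ℕ) (a : ℕ → ℝ) : Prop where
  const_nonneg : 0 ≤ C
  zero : a 0 = 1
  antitone : Antitone a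
  nonneg : ∀ n, 0 ≤ a n
  sub_le : ∀ p q, a p - a (p + q) ≤ 1 - a q
  le_mul_add : ∀ p q r, r₀ ≤ r → a (p + r + q) ≤ a p * a q + C * q * (r : ℝ) ^ (-κ)
  mul_le_add : ∀ p q r, r₀ ≤ r →
    a p * a q ≤ a (p + r + q) + C * q * (r : ℝ) ^ (-κ) + (1 - a r)

/-! ### Block events and the laws of partial maxima. -/

section Events

variable {Ω : Type*} {X : ℕ → Ω → ℝ}

/-- The event that none of the `q` terms of `X` starting at index `p` exceeds `u`. -/
def noExceed (X : ℕ → Ω → ℝ) (p q : ℕ) (u : ℝ) : Set Ω := {ω | ∀ j < q, X (p + j) ω ≤ u}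

lemma partialMax_le_iff {n : ℕ} (hn : 0 < n) (u : ℝ) (ω : Ω) :
    partialMax X n ω ≤ u ↔ ω ∈ noExceed X 0 n u := by
  have : Nonempty (Fin n) := ⟨⟨0, hn⟩⟩
  unfold partialMax
  rw [ciSup_le_iff (Set.finite_range _).bddAbove]
  simp only [noExceed, Set.mem_ofPred_eq, zero_add]
  exact ⟨fun h j hj => h ⟨j, hj⟩, fun h j => h j j.2⟩

lemma noExceed_add (p q₁ q₂ : ℕ) (u : ℝ) :
    noExceed X p (q₁ + q₂) u = noExceed X p q₁ u ∩ noExceed X (p + q₁) q₂ u := by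
  ext ω
  simp only [noExceed, Set.mem_ofPred_eq, Set.mem_inter_iff]
  refine ⟨fun h => ⟨fun j hj => h j (by omega), fun j hj => ?_⟩, fun h j hj => ?_⟩
  · rw [add_assoc]; exact h _ (by omega)
  · by_cases hj' : j < q₁
    · exact h.1 j hj'
    · have := h.2 (j - q₁) (by omega)
      rwa [show p + q₁ + (j - q₁) = p + j by omega] at this

end Events

section Probability

variable {Ω : Type*} [MeasurableSpace Ω]

/-- The distribution function of the maximum of the first `n` terms (equal to `1` for `n = 0`). -/
noncomputable def maxDF (P : Measure Ω) (X : ℕ → Ω → ℝ) (n : ℕ) (u : ℝ) : ℝ :=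
  P.real (noExceed X 0 n u)

variable {P : Measure Ω} {X : ℕ → Ω → ℝ}

lemma measurableSet_noExceed (hX : ∀ j, Measurable (X j)) (p q : ℕ) (u : ℝ) :
    MeasurableSet (noExceed X p q u) := by
  have : noExceed X p q u = ⋂ j, ⋂ (_ : j < q), {ω | X (p + j) ω ≤ u} := by
    ext ω; simp [noExceed]
  rw [this]
  exact .iInter fun j => .iInter fun _ => measurableSet_le (hX _) measurable_const

lemma measureReal_noExceed (hstat : IsStationary P X) (p q : ℕ) (u : ℝ) :
    P.real (noExceed X p q u) = maxDF P X q u := by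
  have hs : MeasurableSet {x : ℕ → ℝ | ∀ j < q, x j ≤ u} := by
    have : {x : ℕ → ℝ | ∀ j < q, x j ≤ u} = ⋂ j, ⋂ (_ : j < q), {x | x j ≤ u} := by
      ext x; simp
    rw [this]
    exact .iInter fun j => .iInter fun _ => measurableSet_le (measurable_pi_apply j) measurable_const
  have h := (hstat p).measure_mem_eq hs
  have h1 : noExceed X p q u = (fun ω j => X (j + p) ω) ⁻¹' {x : ℕ → ℝ | ∀ j < q, x j ≤ u} := by
    ext ω; simp [noExceed, add_comm]
  have h2 : noExceed X 0 q u = (fun ω j => X j ω) ⁻¹' {x : ℕ → ℝ | ∀ j < q, x j ≤ u} := by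
    ext ω; simp [noExceed]
  rw [maxDF, measureReal_def, measureReal_def, h1, h2, h]

lemma maxDF_nonneg (n : ℕ) (u : ℝ) : 0 ≤ maxDF P X n u := measureReal_nonneg

lemma maxDF_one (u : ℝ) : maxDF P X 1 u = marginalDF P X u := by
  simp [maxDF, marginalDF, noExceed]

/-- Together with a finite Lipschitz bound, this allows the denominator `t * lipCoeff g` to be
cleared in `[0, ∞]`. -/
lemma lipCoeff_ne_zero {t : ℕ} {g : (Fin t → ℝ) → ℝ} (hg : g ∈ testClass t) : lipCoeff g ≠ 0 := by
  obtain ⟨-, -, x, y, hxy⟩ := hg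
  intro h
  have hne : y ≠ x := fun h => hxy (by rw [h])
  have h1 : ENNReal.ofReal |g y - g x| / ENNReal.ofReal (∑ k, |y k - x k|) ≤ lipCoeff g :=
    le_iSup_of_le x (le_iSup_of_le y (le_iSup_of_le hne le_rfl))
  rw [h, nonpos_iff_eq_zero, ENNReal.div_eq_zero_iff] at h1
  rcases h1 with h1 | h1
  · rw [ENNReal.ofReal_eq_zero, abs_nonpos_iff, sub_eq_zero] at h1
    exact hxy h1.symm
  · exact ENNReal.ofReal_ne_top h1

/-- The covariance bound that defines `θ`. -/
lemma abs_cov_le_thetaCoeff {s t r : ℕ} (hs : 1 ≤ s) (ht : 1 ≤ t) {f : (Fin s → ℝ) → ℝ}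
    (hf : f ∈ testClass s) {g : (Fin t → ℝ) → ℝ} (hg : g ∈ testClass t) {L : ℝ} (hL : 0 ≤ L)
    (hgL : lipCoeff g ≤ ENNReal.ofReal L) {i : Fin s → ℕ} (hi : Monotone i) {j : Fin t → ℕ}
    (hj : Monotone j) (hij : ∀ a b, i a + r ≤ j b) (hr : thetaCoeff P X r ≠ ∞) :
    |cov[fun ω => f (fun a => X (i a) ω), fun ω => g (fun b => X (j b) ω); P]|
      ≤ (thetaCoeff P X r).toReal * (t * L) := by
  set c := cov[fun ω => f (fun a => X (i a) ω), fun ω => g (fun b => X (j b) ω); P]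
  have h : ENNReal.ofReal |c| / (t * lipCoeff g) ≤ thetaCoeff P X r :=
    le_iSup_of_le s <| le_iSup_of_le t <| le_iSup_of_le hs <| le_iSup_of_le ht <|
      le_iSup_of_le f <| le_iSup_of_le hf <| le_iSup_of_le g <| le_iSup_of_le hg <|
      le_iSup_of_le i <| le_iSup_of_le hi <| le_iSup_of_le j <| le_iSup_of_le hj <|
      le_iSup_of_le hij le_rfl
  have ht0 : (t : ℝ≥0∞) ≠ 0 := by exact_mod_cast (by omega : t ≠ 0)
  rw [ENNReal.div_le_iff (mul_ne_zero ht0 (lipCoeff_ne_zero hg))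
    (ENNReal.mul_ne_top (ENNReal.natCast_ne_top t)
      (ne_top_of_le_ne_top ENNReal.ofReal_ne_top hgL))] at h
  have h2 : ENNReal.ofReal |c| ≤ thetaCoeff P X r * (t * ENNReal.ofReal L) := h.trans (by gcongr)
  have h3 := ENNReal.toReal_mono (by finiteness) h2
  rwa [ENNReal.toReal_ofReal (abs_nonneg _), ENNReal.toReal_mul, ENNReal.toReal_mul,
    ENNReal.toReal_natCast, ENNReal.toReal_ofReal hL] at h3

variable [IsProbabilityMeasure P]

lemma maxDF_zero (u : ℝ) : maxDF P X 0 u = 1 := by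
  simp [maxDF, noExceed]

lemma maxDF_antitone (u : ℝ) : Antitone fun n => maxDF P X n u := fun _ _ h =>
  measureReal_mono fun _ hω j hj => hω j (hj.trans_le h)

lemma maxDF_mono (n : ℕ) : Monotone (maxDF P X n) := fun _ _ h =>
  measureReal_mono fun _ hω j hj => (hω j hj).trans h

/-- Removing an event costs at most the probability of its complement. -/
lemma measureReal_sub_inter_le {A E : Set Ω} (hE : MeasurableSet E) :
    P.real A - P.real (A ∩ E) ≤ 1 - P.real E := by
  have h1 := measureReal_inter_add_sdiff (μ := P) (s := A) hE
  have h2 : P.real (A \ E) ≤ P.real Eᶜ := measureReal_mono fun _ h => h.2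
  rw [probReal_compl_eq_one_sub hE] at h2
  linarith

lemma maxDF_sub_le (hX : ∀ j, Measurable (X j)) (hstat : IsStationary P X) (p q : ℕ) (u : ℝ) :
    maxDF P X p u - maxDF P X (p + q) u ≤ 1 - maxDF P X q u := by
  have h := measureReal_sub_inter_le (P := P) (A := noExceed X 0 p u)
    (measurableSet_noExceed hX (0 + p) q u)
  rwa [← noExceed_add, measureReal_noExceed hstat (0 + p)] at h

/-- Increments of the distribution function of the maximum are controlled by the marginal. -/
lemma maxDF_increment_le (hX : ∀ j, Measurable (X j)) (hstat : IsStationary P X) {u v : ℝ}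
    (huv : u ≤ v) (n : ℕ) :
    maxDF P X n v - maxDF P X n u ≤ n * (marginalDF P X v - marginalDF P X u) := by
  induction n with
  | zero => simp [maxDF_zero]
  | succ n ih =>
    have key : P.real (noExceed X 0 (n + 1) v) - P.real (noExceed X 0 (n + 1) u)
        ≤ (P.real (noExceed X 0 n v) - P.real (noExceed X 0 n u)) +
          (P.real (noExceed X n 1 v) - P.real (noExceed X n 1 u)) := by
      have e : ∀ w, noExceed X 0 (n + 1) w = noExceed X 0 n w ∩ noExceed X n 1 w := fun w => by
        rw [noExceed_add, zero_add]
      have m1 := measurableSet_noExceed hX 0 n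
      have m2 := measurableSet_noExceed hX n 1
      have i1 : noExceed X 0 n u ⊆ noExceed X 0 n v := fun _ h j hj => (h j hj).trans huv
      have i2 : noExceed X n 1 u ⊆ noExceed X n 1 v := fun _ h j hj => (h j hj).trans huv
      rw [e, e, ← measureReal_sdiff i1 (m1 u), ← measureReal_sdiff i2 (m2 u),
        ← measureReal_sdiff (Set.inter_subset_inter i1 i2) ((m1 u).inter (m2 u))]
      refine (measureReal_mono ?_).trans (measureReal_union_le _ _)
      rintro ω ⟨⟨h1, h2⟩, h3⟩
      by_cases h : ω ∈ noExceed X 0 n u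
      · exact Or.inr ⟨h2, fun h' => h3 ⟨h, h'⟩⟩
      · exact Or.inl ⟨h1, h⟩
    rw [measureReal_noExceed hstat n, measureReal_noExceed hstat n, maxDF_one, maxDF_one] at key
    change maxDF P X (n + 1) v - maxDF P X (n + 1) u ≤
      (maxDF P X n v - maxDF P X n u) + _ at key
    push_cast
    linarith

lemma continuous_maxDF (hX : ∀ j, Measurable (X j)) (hstat : IsStationary P X)
    (hcont : Continuous (marginalDF P X)) (n : ℕ) : Continuous (maxDF P X n) := by
  have key : ∀ u v, |maxDF P X n v - maxDF P X n u| ≤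
      n * |marginalDF P X v - marginalDF P X u| := by
    intro u v
    rcases le_total u v with h | h
    · rw [abs_of_nonneg (sub_nonneg.2 (maxDF_mono n h))]
      exact (maxDF_increment_le hX hstat h n).trans (by gcongr; exact le_abs_self _)
    · rw [abs_sub_comm, abs_sub_comm (marginalDF P X v),
        abs_of_nonneg (sub_nonneg.2 (maxDF_mono n h))]
      exact (maxDF_increment_le hX hstat h n).trans (by gcongr; exact le_abs_self _)
  rw [continuous_iff_continuousAt]
  intro u
  rw [ContinuousAt, tendsto_iff_dist_tendsto_zero]
  refine squeeze_zero (fun _ => dist_nonneg) (fun v => key u v) ?_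
  have : Tendsto (fun v => (n : ℝ) * |marginalDF P X v - marginalDF P X u|) (𝓝 u)
      (𝓝 (n * |marginalDF P X u - marginalDF P X u|)) :=
    ((hcont.sub continuous_const).abs.const_mul _).tendsto u
  simpa using this

/-! ### From `θ`-dependence to gap multiplicativity. -/

/-- A Lipschitz function on `ℝ^t` lying between the indicators of `{x ≤ u}` and
`{x ≤ u + ε}`. -/
noncomputable def softBelow (t : ℕ) (u ε : ℝ) (x : Fin t → ℝ) : ℝ :=
  max 0 (1 - (∑ k, max 0 (x k - u)) / ε)

lemma softBelow_nonneg {t : ℕ} (u ε : ℝ) (x : Fin t → ℝ) : 0 ≤ softBelow t u ε x := le_max_left _ _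

lemma softBelow_le_one {t : ℕ} (u : ℝ) {ε : ℝ} (hε : 0 < ε) (x : Fin t → ℝ) :
    softBelow t u ε x ≤ 1 := by
  refine max_le zero_le_one (sub_le_self _ ?_)
  have : 0 ≤ ∑ k, max 0 (x k - u) := Finset.sum_nonneg fun _ _ => le_max_left _ _
  positivity

lemma softBelow_eq_one {t : ℕ} {u ε : ℝ} {x : Fin t → ℝ} (h : ∀ k, x k ≤ u) :
    softBelow t u ε x = 1 := by
  have : ∑ k, max 0 (x k - u) = 0 :=
    Finset.sum_eq_zero fun k _ => max_eq_left (by linarith [h k])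
  simp [softBelow, this]

lemma softBelow_eq_zero {t : ℕ} {u ε : ℝ} (hε : 0 < ε) {x : Fin t → ℝ} {k : Fin t}
    (h : u + ε ≤ x k) : softBelow t u ε x = 0 := by
  refine max_eq_left ?_
  have h1 : max 0 (x k - u) ≤ ∑ k, max 0 (x k - u) :=
    Finset.single_le_sum (f := fun k => max 0 (x k - u)) (fun _ _ => le_max_left _ _)
      (Finset.mem_univ k)
  have h2 : ε ≤ ∑ k, max 0 (x k - u) := by
    linarith [le_max_right 0 (x k - u)]
  rw [sub_nonpos, le_div_iff₀ hε]; linarith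

lemma measurable_softBelow (t : ℕ) (u ε : ℝ) : Measurable (softBelow t u ε) := by
  unfold softBelow; fun_prop

lemma abs_softBelow_sub_le {t : ℕ} (u : ℝ) {ε : ℝ} (hε : 0 < ε) (x y : Fin t → ℝ) :
    |softBelow t u ε y - softBelow t u ε x| ≤ (∑ k, |y k - x k|) / ε := by
  unfold softBelow
  rw [max_comm, max_comm 0 (1 - (∑ k, max 0 (x k - u)) / ε)]
  refine (abs_max_sub_max_le_abs _ _ _).trans ?_
  rw [sub_sub_sub_cancel_left, ← sub_div, abs_div, abs_of_pos hε, ← Finset.sum_sub_distrib]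
  gcongr
  refine (Finset.abs_sum_le_sum_abs _ _).trans (Finset.sum_le_sum fun k _ => ?_)
  rw [max_comm, max_comm 0 (y k - u), abs_sub_comm (y k)]
  refine (abs_max_sub_max_le_abs _ _ _).trans ?_
  rw [sub_sub_sub_cancel_right]

lemma softBelow_mem_testClass {t : ℕ} (ht : 1 ≤ t) (u : ℝ) {ε : ℝ} (hε : 0 < ε) :
    softBelow t u ε ∈ testClass t := by
  refine ⟨measurable_softBelow _ _ _, fun x => ?_, fun _ => u, fun _ => u + ε, ?_⟩
  · rw [abs_of_nonneg (softBelow_nonneg _ _ _)]; exact softBelow_le_one u hε x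
  · rw [softBelow_eq_one fun _ => le_rfl, softBelow_eq_zero hε (k := ⟨0, ht⟩) le_rfl]
    exact one_ne_zero

lemma lipCoeff_softBelow_le (t : ℕ) (u : ℝ) {ε : ℝ} (hε : 0 < ε) :
    lipCoeff (softBelow t u ε) ≤ ENNReal.ofReal (1 / ε) := by
  refine iSup_le fun x => iSup_le fun y => iSup_le fun hxy => ?_
  refine ENNReal.div_le_of_le_mul ?_
  rw [← ENNReal.ofReal_mul (by positivity)]
  refine ENNReal.ofReal_le_ofReal ?_
  rw [one_div_mul_eq_div]
  exact abs_softBelow_sub_le u hε x y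

/-- Approximate independence of two separated blocks, for `θ`-weakly dependent sequences. -/
lemma abs_measureReal_inter_sub_le (hX : ∀ j, Measurable (X j)) (hstat : IsStationary P X)
    {p q r : ℕ} (hr : thetaCoeff P X r ≠ ∞) (u : ℝ) {ε : ℝ} (hε : 0 < ε) :
    |P.real (noExceed X 0 p u ∩ noExceed X (p + r) q u) - maxDF P X p u * maxDF P X q u| ≤
      q * ((thetaCoeff P X r).toReal / ε + (marginalDF P X (u + ε) - marginalDF P X u)) := by
  have hF : 0 ≤ marginalDF P X (u + ε) - marginalDF P X u := by
    rw [← maxDF_one, ← maxDF_one, sub_nonneg]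
    exact maxDF_mono 1 (by linarith)
  have hrhs : 0 ≤ q * ((thetaCoeff P X r).toReal / ε +
      (marginalDF P X (u + ε) - marginalDF P X u)) := by positivity
  -- Empty blocks are treated separately, since `θ` only involves test functions of at least one
  -- variable.
  rcases Nat.eq_zero_or_pos p with rfl | hp
  · have h0 : noExceed X 0 0 u = Set.univ := by simp [noExceed]
    rw [h0, Set.univ_inter, measureReal_noExceed hstat, maxDF_zero, one_mul, sub_self, abs_zero]
    exact hrhs
  rcases Nat.eq_zero_or_pos q with rfl | hq
  · have h0 : noExceed X (p + r) 0 u = Set.univ := by simp [noExceed]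
    rw [h0, Set.inter_univ, measureReal_noExceed hstat, maxDF_zero, mul_one, sub_self, abs_zero]
    exact hrhs
  set A := noExceed X 0 p u with hA
  set B := noExceed X (p + r) q u with hB
  set B' := noExceed X (p + r) q (u + ε) with hB'
  have mA : MeasurableSet A := measurableSet_noExceed hX _ _ _
  have mB : MeasurableSet B := measurableSet_noExceed hX _ _ _
  have mB' : MeasurableSet B' := measurableSet_noExceed hX _ _ _
  -- Only the later block must be smoothed: `θ` puts no Lipschitz condition on the function of the
  -- past, so `A` keeps its indicator. `W` lies between the indicators of `B` and `B'`.
  set W : Ω → ℝ := fun ω => softBelow q u ε fun b : Fin q => X (p + r + b) ω with hW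
  have mW : Measurable W := (measurable_softBelow q u ε).comp (measurable_pi_lambda _ fun _ => hX _)
  have iW : Integrable W P := by
    refine Integrable.of_bound mW.aestronglyMeasurable 1 (ae_of_all _ fun ω => ?_)
    rw [Real.norm_of_nonneg (softBelow_nonneg _ _ _)]
    exact softBelow_le_one u hε _
  have lowW : ∀ ω, B.indicator 1 ω ≤ W ω := fun ω => by
    by_cases h : ω ∈ B
    · rw [Set.indicator_of_mem h]
      exact (softBelow_eq_one fun k => h k k.2).ge
    · rw [Set.indicator_of_notMem h]; exact softBelow_nonneg _ _ _
  have upW : ∀ ω, W ω ≤ B'.indicator 1 ω := fun ω => by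
    by_cases h : ω ∈ B'
    · rw [Set.indicator_of_mem h]; exact softBelow_le_one u hε _
    · rw [Set.indicator_of_notMem h]
      simp only [hB', noExceed, Set.mem_ofPred_eq, not_forall, not_le] at h
      obtain ⟨k, hk, h⟩ := h
      exact (softBelow_eq_zero hε (k := ⟨k, hk⟩) h.le).le
  have ind : ∀ {E : Set Ω} (_ : MeasurableSet E), Integrable (E.indicator (1 : Ω → ℝ)) P :=
    fun hE => (integrable_const 1).indicator hE
  have l1 : P.real B ≤ ∫ ω, W ω ∂P := by
    rw [← integral_indicator_one mB]; exact integral_mono (ind mB) iW lowW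
  have l2 : ∫ ω, W ω ∂P ≤ P.real B' := by
    rw [← integral_indicator_one mB']; exact integral_mono iW (ind mB') upW
  have setint : ∀ {E : Set Ω} (_ : MeasurableSet E),
      ∫ ω in A, E.indicator (1 : Ω → ℝ) ω ∂P = P.real (A ∩ E) := fun {E} hE => by
    rw [integral_indicator_one hE, measureReal_restrict_apply hE, Set.inter_comm]
  have l3 : P.real (A ∩ B) ≤ ∫ ω in A, W ω ∂P := by
    rw [← setint mB]; exact integral_mono (ind mB).integrableOn iW.integrableOn lowW
  have l4 : ∫ ω in A, W ω ∂P ≤ P.real (A ∩ B') := by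
    rw [← setint mB']; exact integral_mono iW.integrableOn (ind mB').integrableOn upW
  have hBB : B ⊆ B' := fun ω h j hj => (h j hj).trans (by linarith)
  have l5 : P.real (A ∩ B') - P.real (A ∩ B) ≤ P.real B' - P.real B := by
    rw [← measureReal_sdiff hBB mB,
      ← measureReal_sdiff (Set.inter_subset_inter_right A hBB) (mA.inter mB)]
    exact measureReal_mono fun ω h => ⟨h.1.2, fun h' => h.2 ⟨h.1.1, h'⟩⟩
  have l6 : P.real B' - P.real B ≤ q * (marginalDF P X (u + ε) - marginalDF P X u) := by
    rw [hB', hB, measureReal_noExceed hstat, measureReal_noExceed hstat]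
    exact maxDF_increment_le hX hstat (by linarith) q
  set f : (Fin p → ℝ) → ℝ := Set.indicator {x | ∀ k, x k ≤ u} 1 with hf
  have mf : MeasurableSet {x : Fin p → ℝ | ∀ k, x k ≤ u} := by
    have : {x : Fin p → ℝ | ∀ k, x k ≤ u} = ⋂ k, {x | x k ≤ u} := by ext x; simp
    rw [this]
    exact .iInter fun k => measurableSet_le (measurable_pi_apply k) measurable_const
  have hfc : f ∈ testClass p := by
    refine ⟨measurable_one.indicator mf, fun x => ?_, fun _ => u, fun _ => u + 1, ?_⟩
    · by_cases h : x ∈ {x : Fin p → ℝ | ∀ k, x k ≤ u} <;> simp [hf, h]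
    · have h1 : (fun _ => u) ∈ {x : Fin p → ℝ | ∀ k, x k ≤ u} := fun _ => le_rfl
      have h2 : (fun _ => u + 1) ∉ {x : Fin p → ℝ | ∀ k, x k ≤ u} := fun h => by
        have := h ⟨0, hp⟩; linarith
      rw [hf, Set.indicator_of_mem h1, Set.indicator_of_notMem h2]
      exact one_ne_zero
  have hcov := abs_cov_le_thetaCoeff (P := P) (X := X) (r := r) hp hq hfc
    (softBelow_mem_testClass hq u hε) (L := 1 / ε) (by positivity) (lipCoeff_softBelow_le q u hε)
    (i := fun a => a) (fun _ _ h => h) (j := fun b => p + r + b)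
    (fun _ _ h => Nat.add_le_add_left h _) (fun a b => by have := a.2; omega) hr
  have hfX : (fun ω => f fun a : Fin p => X a ω) = A.indicator 1 := by
    funext ω
    have : (fun a : Fin p => X a ω) ∈ {x : Fin p → ℝ | ∀ k, x k ≤ u} ↔ ω ∈ A := by
      simp only [hA, noExceed, Set.mem_ofPred_eq, zero_add]
      exact ⟨fun h j hj => h ⟨j, hj⟩, fun h k => h k k.2⟩
    by_cases h : ω ∈ A
    · rw [Set.indicator_of_mem h, hf, Set.indicator_of_mem (this.2 h)]; rfl
    · rw [Set.indicator_of_notMem h, hf, Set.indicator_of_notMem (mt this.1 h)]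
  have hprod : ∫ ω, (A.indicator (1 : Ω → ℝ) * W) ω ∂P = ∫ ω in A, W ω ∂P := by
    rw [← integral_indicator mA]
    refine integral_congr_ae (ae_of_all _ fun ω => ?_)
    by_cases h : ω ∈ A <;> simp [h]
  rw [hfX, covariance_eq_sub, hprod, integral_indicator_one mA] at hcov
  rotate_left
  · exact MemLp.of_bound (measurable_one.indicator mA).aestronglyMeasurable 1
      (ae_of_all _ fun ω => by by_cases h : ω ∈ A <;> simp [h])
  · refine MemLp.of_bound mW.aestronglyMeasurable 1 (ae_of_all _ fun ω => ?_)
    rw [Real.norm_of_nonneg (softBelow_nonneg _ _ _)]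
    exact softBelow_le_one u hε _
  have eB : P.real B = maxDF P X q u := measureReal_noExceed hstat _ _ _
  have eA : P.real A = maxDF P X p u := rfl
  rw [← eA, ← eB]
  have hA0 : 0 ≤ P.real A := measureReal_nonneg
  have hA1 : P.real A ≤ 1 := measureReal_le_one
  have m1 : 0 ≤ P.real A * ((∫ ω, W ω ∂P) - P.real B) := mul_nonneg hA0 (by linarith)
  have m2 : P.real A * ((∫ ω, W ω ∂P) - P.real B) ≤ (∫ ω, W ω ∂P) - P.real B :=
    mul_le_of_le_one_left (by linarith) hA1
  have e1 : (q : ℝ) * ((thetaCoeff P X r).toReal / ε + (marginalDF P X (u + ε) - marginalDF P X u))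
      = (thetaCoeff P X r).toReal * (q * (1 / ε)) +
        q * (marginalDF P X (u + ε) - marginalDF P X u) := by ring
  rw [e1]
  rw [abs_le] at hcov ⊢
  constructor <;> nlinarith [hcov.1, hcov.2]

/-- Under a concentration bound on the marginal and a polynomial rate for `θ`, the distribution
functions of the maxima are gap multiplicative, uniformly in the level. -/
lemma exists_isGapMultiplicative_maxDF (hX : ∀ j, Measurable (X j)) (hstat : IsStationary P X)
    {b B β : ℝ} (hb : 0 < b) (hB : 0 < B)
    (hconc : ∀ x u : ℝ, 0 < u → marginalDF P X (x + u) - marginalDF P X x ≤ B * u ^ b)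
    (hdep : IsThetaWeaklyDependent P X)
    (hrate : (fun r : ℕ => (thetaCoeff P X r).toReal) =O[atTop] fun r : ℕ => (r : ℝ) ^ (-β)) :
    ∃ (C : ℝ) (r₀ : ℕ), ∀ u,
      IsGapMultiplicative C (β * b / (1 + b)) r₀ (fun n => maxDF P X n u) := by
  obtain ⟨c, hc, hcr⟩ := hrate.exists_pos
  have hfin : ∀ᶠ r in atTop, thetaCoeff P X r < ∞ :=
    hdep.eventually (gt_mem_nhds ENNReal.zero_lt_top)
  obtain ⟨r₀, hr₀⟩ := eventually_atTop.1 ((hcr.bound.and hfin).and (eventually_ge_atTop 1))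
  have key : ∀ u p q r, r₀ ≤ r →
      |P.real (noExceed X 0 p u ∩ noExceed X (p + r) q u) - maxDF P X p u * maxDF P X q u| ≤
        (c + B) * q * (r : ℝ) ^ (-(β * b / (1 + b))) := by
    intro u p q r hr
    obtain ⟨⟨h1, h2⟩, h3⟩ := hr₀ r hr
    have hr0 : (0 : ℝ) < r := by exact_mod_cast h3
    have h1b : 0 < 1 + b := by linarith
    rw [Real.norm_of_nonneg ENNReal.toReal_nonneg,
      Real.norm_of_nonneg (Real.rpow_nonneg hr0.le _)] at h1
    -- This choice balances the two errors: `r ^ (-β) / ε` and `ε ^ b` both equal `r ^ (-(β * b / (1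
    -- + b)))`.
    set ε : ℝ := (r : ℝ) ^ (-(β / (1 + b))) with hε
    have hε0 : 0 < ε := Real.rpow_pos_of_pos hr0 _
    refine (abs_measureReal_inter_sub_le hX hstat h2.ne u hε0).trans ?_
    have e1 : (thetaCoeff P X r).toReal / ε ≤ c * (r : ℝ) ^ (-(β * b / (1 + b))) := by
      rw [div_le_iff₀ hε0, mul_assoc, hε, ← Real.rpow_add hr0]
      have : -(β * b / (1 + b)) + -(β / (1 + b)) = -β := by field_simp; ring
      rwa [this]
    have e2 : marginalDF P X (u + ε) - marginalDF P X u ≤ B * (r : ℝ) ^ (-(β * b / (1 + b))) := by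
      convert hconc u ε hε0 using 2
      rw [hε, ← Real.rpow_mul hr0.le]
      congr 1
      ring
    calc _ ≤ (q : ℝ) * (c * (r : ℝ) ^ (-(β * b / (1 + b))) + B * (r : ℝ) ^ (-(β * b / (1 + b)))) := by
          gcongr
      _ = _ := by ring
  refine ⟨c + B, r₀, fun u => ⟨by positivity, maxDF_zero u, maxDF_antitone u,
    fun n => maxDF_nonneg n u, fun p q => maxDF_sub_le hX hstat p q u, fun p q r hr => ?_,
    fun p q r hr => ?_⟩⟩
  · have h := (abs_le.1 (key u p q r hr)).2
    have h' : maxDF P X (p + r + q) u ≤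
        P.real (noExceed X 0 p u ∩ noExceed X (p + r) q u) := by
      refine measureReal_mono ?_
      rw [noExceed_add, noExceed_add, zero_add, zero_add]
      exact Set.inter_subset_inter_left _ Set.inter_subset_left
    linarith
  · have h := (abs_le.1 (key u p q r hr)).1
    have h' := measureReal_sub_inter_le (P := P)
      (A := noExceed X 0 p u ∩ noExceed X (p + r) q u) (measurableSet_noExceed hX (0 + p) r u)
    have h2 : maxDF P X (p + r + q) u =
        P.real (noExceed X 0 p u ∩ noExceed X (p + r) q u ∩ noExceed X (0 + p) r u) := by
      rw [maxDF, noExceed_add, noExceed_add, zero_add, zero_add, Set.inter_right_comm]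
    rw [← h2, measureReal_noExceed hstat] at h'
    linarith

end Probability

/-! ### Gap lengths and elementary exponential estimates. -/

/-- A gap length that is negligible against `m` and still kills an error `m * r ^ (-κ)`. -/
lemma exists_gap_length {κ : ℝ} (hκ : 1 < κ) :
    ∃ r : ℕ → ℕ, Tendsto r atTop atTop ∧ (∀ k : ℕ, ∀ᶠ m in atTop, k * r m ≤ m) ∧
      Tendsto (fun m : ℕ => (m : ℝ) * (r m : ℝ) ^ (-κ)) atTop (𝓝 0) := by
  have hκ0 : 0 < κ := by linarith
  have hinv : κ⁻¹ < 1 := inv_lt_one_of_one_lt₀ hκ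
  -- Take `r m = ⌈m ^ ρ⌉` with `1 / κ < ρ < 1`: `ρ < 1` makes it negligible against `m`, and `ρ * κ
  -- > 1` kills the error.
  obtain ⟨ρ, h1, h2⟩ := exists_between hinv
  have hρ0 : 0 < ρ := (inv_pos.2 hκ0).trans h1
  have hρκ : 1 < ρ * κ := by rwa [inv_lt_iff_one_lt_mul₀ hκ0] at h1
  have hcast : Tendsto (fun m : ℕ => (m : ℝ)) atTop atTop := tendsto_natCast_atTop_atTop
  refine ⟨fun m => ⌈(m : ℝ) ^ ρ⌉₊, ?_, fun k => ?_, ?_⟩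
  · exact tendsto_nat_ceil_atTop.comp ((tendsto_rpow_atTop hρ0).comp hcast)
  · have hlim : Tendsto (fun m : ℕ => (k : ℝ) * (m : ℝ) ^ (-(1 - ρ)) + k / (m : ℝ)) atTop (𝓝 0) := by
      have := ((tendsto_rpow_neg_atTop (sub_pos.2 h2)).comp hcast).const_mul (k : ℝ)
      simpa using this.add (tendsto_const_div_atTop_nhds_zero_nat (k : ℝ))
    filter_upwards [hlim.eventually (ge_mem_nhds one_pos), eventually_gt_atTop 0] with m hm hm0
    have hm0' : (0 : ℝ) < m := by exact_mod_cast hm0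
    have hceil := (Nat.ceil_lt_add_one (Real.rpow_nonneg hm0'.le ρ)).le
    have e : (m : ℝ) ^ (-(1 - ρ)) * m = (m : ℝ) ^ ρ := by
      nth_rw 2 [← Real.rpow_one (m : ℝ)]
      rw [← Real.rpow_add hm0']; congr 1; ring
    have h3 : ((k : ℝ) * (m : ℝ) ^ (-(1 - ρ)) + k / m) * m ≤ 1 * m :=
      mul_le_mul_of_nonneg_right hm hm0'.le
    rw [add_mul, mul_assoc, e, div_mul_cancel₀ _ hm0'.ne', one_mul] at h3
    have : (k : ℝ) * ⌈(m : ℝ) ^ ρ⌉₊ ≤ m := by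
      refine le_trans (mul_le_mul_of_nonneg_left hceil k.cast_nonneg) ?_
      linarith
    exact_mod_cast this
  · refine squeeze_zero' (.of_forall fun m => by positivity) ?_
      ((tendsto_rpow_neg_atTop (sub_pos.2 hρκ)).comp hcast)
    filter_upwards [eventually_gt_atTop 0] with m hm0
    have hm0' : (0 : ℝ) < m := by exact_mod_cast hm0
    have h3 : (⌈(m : ℝ) ^ ρ⌉₊ : ℝ) ^ (-κ) ≤ ((m : ℝ) ^ ρ) ^ (-κ) :=
      Real.rpow_le_rpow_of_nonpos (Real.rpow_pos_of_pos hm0' _) (Nat.le_ceil _) (by linarith)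
    refine (mul_le_mul_of_nonneg_left h3 hm0'.le).trans ?_
    rw [← Real.rpow_mul hm0'.le]
    nth_rw 1 [← Real.rpow_one (m : ℝ)]
    rw [← Real.rpow_add hm0', Function.comp_apply]
    apply le_of_eq; congr 1; ring

lemma abs_exp_neg_sub_exp_neg_le {x y : ℝ} (hx : 0 ≤ x) (hy : 0 ≤ y) :
    |Real.exp (-x) - Real.exp (-y)| ≤ |x - y| := by
  wlog hxy : x ≤ y generalizing x y
  · rw [abs_sub_comm, abs_sub_comm x]; exact this hy hx (le_of_not_ge hxy)
  rw [abs_of_nonneg (sub_nonneg.2 (Real.exp_le_exp.2 (neg_le_neg hxy))),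
    abs_sub_comm, abs_of_nonneg (sub_nonneg.2 hxy)]
  have h1 : Real.exp (-y) = Real.exp (-x) * Real.exp (-(y - x)) := by
    rw [← Real.exp_add]; congr 1; ring
  have h2 := Real.one_sub_le_exp_neg (y - x)
  have h3 : Real.exp (-x) ≤ 1 := Real.exp_le_one_iff.2 (by linarith)
  have h4 : Real.exp (-x) * (1 - Real.exp (-(y - x))) ≤ 1 * (y - x) :=
    mul_le_mul h3 (by linarith)
      (sub_nonneg.2 (Real.exp_le_one_iff.2 (by linarith))) zero_le_one
  rw [h1]; linarith

/-- Replacing the rate `s` by a relatively close rate changes `exp (-s)` little, uniformly. -/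
lemma abs_exp_neg_sub_exp_neg_mul_le {s d : ℝ} (hs : 0 ≤ s) (hd : 0 ≤ d) :
    |Real.exp (-s) - Real.exp (-(s * (1 + d)))| ≤ d := by
  have h1 : Real.exp (-(s * (1 + d))) = Real.exp (-s) * Real.exp (-(s * d)) := by
    rw [← Real.exp_add]; congr 1; ring
  have h2 := Real.one_sub_le_exp_neg (s * d)
  have h3 : Real.exp (-(s * d)) ≤ 1 := Real.exp_le_one_iff.2 (by nlinarith)
  -- The difference is at most `exp (-s) * s * d`, and boundedness of `s * exp (-s)` removes the
  -- dependence on `s`.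
  have h4 : s * Real.exp (-s) ≤ 1 := by
    rw [Real.exp_neg, ← div_eq_mul_inv, div_le_one (Real.exp_pos s)]
    linarith [Real.add_one_le_exp s]
  rw [h1, abs_of_nonneg (by nlinarith [Real.exp_pos (-s)])]
  nlinarith [Real.exp_pos (-s)]

/-! ### Geometric decay of gap multiplicative sequences. -/

namespace IsGapMultiplicative

variable {C κ : ℝ} {r₀ : ℕ} {a : ℕ → ℝ}

lemma le_one (h : IsGapMultiplicative C κ r₀ a) (n : ℕ) : a n ≤ 1 :=
  h.zero ▸ h.antitone n.zero_le

/-- Peel off `k` blocks of length `r`, each preceded by a gap `g`; every block contributes a factor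
`a r` and one error term. -/
lemma le_pow_add (h : IsGapMultiplicative C κ r₀ a) {g : ℕ} (hg : r₀ ≤ g) (r k : ℕ) :
    a (k * (g + r)) ≤ a r ^ k + k * (C * r * (g : ℝ) ^ (-κ)) := by
  induction k with
  | zero => simp [h.zero]
  | succ k ih =>
    have h1 := h.le_mul_add (k * (g + r)) r g hg
    rw [show k * (g + r) + g + r = (k + 1) * (g + r) by ring] at h1
    have hC := h.const_nonneg
    have h2 : a (k * (g + r)) * a r ≤ (a r ^ k + k * (C * r * (g : ℝ) ^ (-κ))) * a r :=
      mul_le_mul_of_nonneg_right ih (h.nonneg r)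
    have h3 : k * (C * r * (g : ℝ) ^ (-κ)) * a r ≤ k * (C * r * (g : ℝ) ^ (-κ)) :=
      mul_le_of_le_one_right (by positivity) (h.le_one r)
    push_cast
    rw [pow_succ]
    linarith

/-- The geometric bound that results from an infinitely long gap. -/
lemma tendsto_pow_bound (hκ : 0 < κ) (C x : ℝ) (r k : ℕ) :
    Tendsto (fun g : ℕ => x ^ k + k * (C * r * (g : ℝ) ^ (-κ))) atTop (𝓝 (x ^ k)) := by
  have := ((tendsto_rpow_neg_atTop hκ).comp tendsto_natCast_atTop_atTop).const_mul (k * (C * r))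
  simpa [mul_assoc, Function.comp_def] using this.const_add (x ^ k)

/-- Uniform decay past a place where the sequence is below `x < 1`. -/
lemma exists_forall_le (hκ : 0 < κ) (C : ℝ) (r₀ : ℕ) {x : ℝ} (hx : x < 1) (M : ℕ)
    {ε : ℝ} (hε : 0 < ε) :
    ∃ N : ℕ, ∀ a, IsGapMultiplicative C κ r₀ a → a M ≤ x → ∀ n ≥ N, a n ≤ ε := by
  obtain ⟨k, hk⟩ := exists_pow_lt_of_lt_one hε hx
  obtain ⟨g, hg, hg'⟩ := (((tendsto_pow_bound hκ C x M k).eventually (ge_mem_nhds hk)).and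
    (eventually_ge_atTop r₀)).exists
  refine ⟨k * (g + M), fun a h ha n hn => ((h.antitone hn).trans (h.le_pow_add hg' M k)).trans
    (le_trans ?_ hg)⟩
  gcongr
  exact h.nonneg M

/-- A single value below `1` would already force decay to `0`, below any positive bound. -/
lemma eq_one_of_forall_lt (h : IsGapMultiplicative C κ r₀ a) (hκ : 0 < κ) {x : ℝ} (hx : 0 < x)
    (ha : ∀ k, x < a k) (r : ℕ) : a r = 1 := by
  refine le_antisymm (h.le_one r) ?_
  by_contra! hr
  obtain ⟨N, hN⟩ := exists_forall_le hκ C r₀ hr r hx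
  exact absurd (hN a h le_rfl N le_rfl) (not_le.2 (ha N))

end IsGapMultiplicative

/-! ### Exponential behaviour on the time scale of the crossing. -/

/-- The filter of pairs `(a, m)` of a gap multiplicative sequence `a` and the place `m → ∞` where it
crosses the level `exp (-1)`. -/
def crossingFilter (C κ : ℝ) (r₀ : ℕ) : Filter ((ℕ → ℝ) × ℕ) :=
  comap Prod.snd atTop ⊓ 𝓟 {x | IsGapMultiplicative C κ r₀ x.1 ∧ x.1 (x.2 + 1) ≤ Real.exp (-1) ∧
    Real.exp (-1) < x.1 x.2}

section Crossing

variable {C κ : ℝ} {r₀ : ℕ}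

lemma tendsto_snd_crossingFilter : Tendsto Prod.snd (crossingFilter C κ r₀) atTop :=
  tendsto_comap.mono_left inf_le_left

lemma eventually_crossingFilter : ∀ᶠ x in crossingFilter C κ r₀, IsGapMultiplicative C κ r₀ x.1 ∧
    x.1 (x.2 + 1) ≤ Real.exp (-1) ∧ Real.exp (-1) < x.1 x.2 :=
  mem_inf_of_right (mem_principal_self _)

/-- Limits along `crossingFilter` are limits in `m` uniform over all sequences crossing at `m`. -/
lemma eventually_crossingFilter_iff {p : (ℕ → ℝ) × ℕ → Prop} :
    (∀ᶠ x in crossingFilter C κ r₀, p x) ↔ ∃ M, ∀ m ≥ M, ∀ a, IsGapMultiplicative C κ r₀ a →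
      a (m + 1) ≤ Real.exp (-1) → Real.exp (-1) < a m → p (a, m) := by
  rw [crossingFilter, eventually_inf_principal, eventually_comap, eventually_atTop]
  refine exists_congr fun M => forall₂_congr fun m _ => ⟨fun h a h1 h2 h3 => h (a, m) rfl ⟨h1, h2, h3⟩,
    fun h x hx hx' => ?_⟩
  subst hx
  exact h x.1 hx'.1 hx'.2.1 hx'.2.2

/-- Suppose `a (r m) < 1 - ε`. For fixed large `k`, `k` blocks of length `r m` with gaps `r m` fit
before `m`, and give `a m ≤ (1 - ε) ^ k + o(1) < exp (-1)`, contrary to the crossing at `m`. -/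
lemma eventually_one_sub_gap_le {r : ℕ → ℕ} (hr : Tendsto r atTop atTop)
    (hrm : ∀ k : ℕ, ∀ᶠ m in atTop, k * r m ≤ m)
    (hrκ : Tendsto (fun m : ℕ => (m : ℝ) * (r m : ℝ) ^ (-κ)) atTop (𝓝 0)) {ε : ℝ} (hε : 0 < ε) :
    ∀ᶠ x in crossingFilter C κ r₀, 1 - x.1 (r x.2) ≤ ε := by
  rcases le_or_gt 1 ε with h1 | h1
  · filter_upwards [eventually_crossingFilter] with x hx
    linarith [hx.1.nonneg (r x.2)]
  have he : 0 < Real.exp (-1) := Real.exp_pos _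
  obtain ⟨k, hk⟩ := exists_pow_lt_of_lt_one (half_pos he) (sub_lt_self 1 hε)
  have hlim : Tendsto (fun m : ℕ => k * (C * ((m : ℝ) * (r m : ℝ) ^ (-κ)))) atTop (𝓝 0) := by
    simpa using (hrκ.const_mul C).const_mul (k : ℝ)
  filter_upwards [eventually_crossingFilter, tendsto_snd_crossingFilter.eventually
    (((hlim.eventually (ge_mem_nhds (half_pos he))).and (hrm (k * 2))).and
      ((hr.eventually_ge_atTop r₀).and (hrm 1)))] with x ⟨hx, _, hx2⟩ ⟨⟨h2, h3⟩, h4, h5⟩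
  by_contra! h6
  have h7 := hx.le_pow_add h4 (r x.2) k
  have h8 : x.1 x.2 ≤ x.1 (k * (r x.2 + r x.2)) := hx.antitone (by
    rw [← two_mul, ← mul_assoc]; exact h3)
  have h9 : x.1 (r x.2) ^ k ≤ (1 - ε) ^ k :=
    pow_le_pow_left₀ (hx.nonneg _) (by linarith) k
  have h10 : (k : ℝ) * (C * r x.2 * (r x.2 : ℝ) ^ (-κ)) ≤
      k * (C * ((x.2 : ℝ) * (r x.2 : ℝ) ^ (-κ))) := by
    have : (r x.2 : ℝ) ≤ x.2 := by exact_mod_cast (one_mul (r x.2)) ▸ h5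
    have := hx.const_nonneg
    rw [mul_assoc C]
    gcongr
  linarith

/-- Asymptotic multiplicativity on the time scale of the crossing. -/
lemma eventually_abs_add_sub_mul_le (hκ : 1 < κ) (T : ℕ) {ε : ℝ} (hε : 0 < ε) :
    ∀ᶠ x in crossingFilter C κ r₀, ∀ p q, p + q ≤ T * x.2 →
      |x.1 (p + q) - x.1 p * x.1 q| ≤ ε := by
  obtain ⟨r, hr, hrm, hrκ⟩ := exists_gap_length hκ
  have hlim : Tendsto (fun m : ℕ => C * T * ((m : ℝ) * (r m : ℝ) ^ (-κ))) atTop (𝓝 0) := by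
    simpa using hrκ.const_mul (C * T)
  filter_upwards [eventually_crossingFilter, eventually_one_sub_gap_le hr hrm hrκ
    (show 0 < ε / 4 by positivity), tendsto_snd_crossingFilter.eventually
    ((hlim.eventually (ge_mem_nhds (half_pos hε))).and (hr.eventually_ge_atTop r₀))]
    with x ⟨hx, _, _⟩ hx1 ⟨hx2, hx3⟩ p q hpq
  obtain ⟨a, m⟩ := x
  dsimp only at *
  have hp0 := hx.nonneg p
  have hp1 := hx.le_one p
  -- A block no longer than the gap is negligible. From a longer one an initial piece of length `r
  -- m` is sacrificed as the gap.
  rcases le_total q (r m) with hq | hq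
  · have h1 := hx.sub_le p q
    have h2 := hx.antitone hq
    have h3 : a (p + q) ≤ a p := hx.antitone (Nat.le_add_right p q)
    have h4 : a p * a q ≤ a p := mul_le_of_le_one_right hp0 (hx.le_one q)
    have h5 : a p * (1 - a q) ≤ 1 - a q := mul_le_of_le_one_left (sub_nonneg.2 (hx.le_one q)) hp1
    rw [abs_le]; constructor <;> linarith
  · obtain ⟨s, rfl⟩ := Nat.exists_eq_add_of_le hq
    have h1 := hx.le_mul_add p s (r m) hx3
    have h2 := hx.mul_le_add p s (r m) hx3
    have h3 := hx.sub_le s (r m)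
    rw [add_comm s] at h3
    have h4 : a (r m + s) ≤ a s := hx.antitone (Nat.le_add_left _ _)
    have h5 : a p * (a s - a (r m + s)) ≤ a s - a (r m + s) :=
      mul_le_of_le_one_left (sub_nonneg.2 h4) hp1
    have h5' : 0 ≤ a p * (a s - a (r m + s)) := mul_nonneg hp0 (sub_nonneg.2 h4)
    have h6 : C * s * (r m : ℝ) ^ (-κ) ≤ ε / 2 := by
      refine le_trans ?_ hx2
      have hs : (s : ℝ) ≤ T * m := by exact_mod_cast (by omega : s ≤ T * m)
      have := hx.const_nonneg
      calc C * s * (r m : ℝ) ^ (-κ) ≤ C * (T * m) * (r m : ℝ) ^ (-κ) := by gcongr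
        _ = _ := by ring
    rw [add_assoc p] at h1 h2
    rw [abs_le]; constructor <;> linarith

lemma tendsto_mul_div_sub_pow (hκ : 1 < κ) {k : ℕ} (j : ℕ) :
    Tendsto (fun x : (ℕ → ℝ) × ℕ => x.1 (j * (x.2 / k)) - x.1 (x.2 / k) ^ j)
      (crossingFilter C κ r₀) (𝓝 0) := by
  induction j with
  | zero =>
    refine tendsto_const_nhds.congr' ?_
    filter_upwards [eventually_crossingFilter] with x hx
    simp [hx.1.zero]
  | succ j ih =>
    have h1 : Tendsto (fun x : (ℕ → ℝ) × ℕ =>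
        x.1 (j * (x.2 / k) + x.2 / k) - x.1 (j * (x.2 / k)) * x.1 (x.2 / k))
        (crossingFilter C κ r₀) (𝓝 0) := by
      rw [Metric.tendsto_nhds]
      intro ε hε
      filter_upwards [eventually_abs_add_sub_mul_le hκ (j + 1) (half_pos hε)] with x hx
      rw [Real.dist_eq, sub_zero]
      refine lt_of_le_of_lt (hx _ _ ?_) (half_lt_self hε)
      rw [← Nat.succ_mul]
      exact Nat.mul_le_mul_left _ (Nat.div_le_self _ _)
    have h2 : Tendsto (fun x : (ℕ → ℝ) × ℕ =>
        x.1 (x.2 / k) * (x.1 (j * (x.2 / k)) - x.1 (x.2 / k) ^ j))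
        (crossingFilter C κ r₀) (𝓝 0) := by
      refine squeeze_zero_norm' ?_ (tendsto_zero_iff_norm_tendsto_zero.1 ih)
      filter_upwards [eventually_crossingFilter] with x hx
      rw [norm_mul]
      refine mul_le_of_le_one_left (norm_nonneg _) ?_
      rw [Real.norm_of_nonneg (hx.1.nonneg _)]
      exact hx.1.le_one _
    refine (by simpa using h1.add h2 : Tendsto _ _ (𝓝 (0 : ℝ))).congr fun x => ?_
    rw [Nat.succ_mul, pow_succ]
    ring

/-- The place `k * (m / k)` is within `k` of `m + 1`, less than a gap, so the value of `a` there is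
squeezed to `exp (-1)`; multiplicativity turns it into a `k`-th power. -/
lemma tendsto_div_pow (hκ : 1 < κ) {k : ℕ} (hk : 0 < k) :
    Tendsto (fun x : (ℕ → ℝ) × ℕ => x.1 (x.2 / k) ^ k)
      (crossingFilter C κ r₀) (𝓝 (Real.exp (-1))) := by
  suffices h : Tendsto (fun x : (ℕ → ℝ) × ℕ => x.1 (k * (x.2 / k)))
      (crossingFilter C κ r₀) (𝓝 (Real.exp (-1))) by
    simpa using h.sub (tendsto_mul_div_sub_pow hκ (k := k) k)
  obtain ⟨r, hr, hrm, hrκ⟩ := exists_gap_length hκ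
  rw [Metric.tendsto_nhds]
  intro ε hε
  filter_upwards [eventually_crossingFilter, eventually_one_sub_gap_le hr hrm hrκ (half_pos hε),
    tendsto_snd_crossingFilter.eventually (hr.eventually_ge_atTop (k + 1))] with x ⟨hx, h1, h2⟩ h3 h4
  obtain ⟨a, m⟩ := x
  dsimp only at *
  have h5 : k * (m / k) ≤ m := Nat.mul_div_le m k
  have h6 := hx.antitone h5
  have h7 := hx.sub_le (k * (m / k)) (m + 1 - k * (m / k))
  rw [show k * (m / k) + (m + 1 - k * (m / k)) = m + 1 by omega] at h7
  have h8 : m + 1 - k * (m / k) ≤ r m := by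
    have := Nat.div_add_mod m k
    have := Nat.mod_lt m hk
    omega
  have h9 := hx.antitone h8
  rw [Real.dist_eq, abs_lt]
  constructor <;> linarith

lemma tendsto_mul_div (hκ : 1 < κ) {k : ℕ} (hk : 0 < k) (j : ℕ) :
    Tendsto (fun x : (ℕ → ℝ) × ℕ => x.1 (j * (x.2 / k)))
      (crossingFilter C κ r₀) (𝓝 (Real.exp (-(j / k : ℝ)))) := by
  have h1 : Tendsto (fun x : (ℕ → ℝ) × ℕ => x.1 (x.2 / k))
      (crossingFilter C κ r₀) (𝓝 (Real.exp (-1) ^ (k : ℝ)⁻¹)) := by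
    refine ((tendsto_div_pow hκ hk).rpow_const (Or.inl (Real.exp_pos _).ne')).congr' ?_
    filter_upwards [eventually_crossingFilter] with x hx
    exact Real.pow_rpow_inv_natCast (hx.1.nonneg _) hk.ne'
  have h2 := (tendsto_mul_div_sub_pow (C := C) (r₀ := r₀) hκ (k := k) j).add (h1.pow j)
  simp only [sub_add_cancel, zero_add] at h2
  convert h2 using 2
  rw [← Real.exp_mul, ← Real.exp_nat_mul]
  congr 1
  ring

/-- On the time scale of the crossing, the sequence is asymptotically exponential. -/
lemma eventually_abs_sub_exp_le (hκ : 1 < κ) (T : ℕ) {ε : ℝ} (hε : 0 < ε) :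
    ∀ᶠ x in crossingFilter C κ r₀, ∀ n ≤ T * x.2,
      |x.1 n - Real.exp (-(n / x.2 : ℝ))| ≤ ε := by
  obtain ⟨k, hk⟩ := exists_nat_gt (4 / ε)
  have hk0' : (0 : ℝ) < k := (by positivity : (0 : ℝ) < 4 / ε).trans hk
  have hk0 : 0 < k := by exact_mod_cast hk0'
  have hkε : 2 / k ≤ ε / 2 := by
    rw [div_lt_iff₀ hε] at hk
    rw [div_le_iff₀ hk0']; linarith
  -- On a grid of mesh `q = m / k`, only finitely many points matter: `m ≤ 2 * k * q` gives `T * m ≤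
  -- 2 * k * T * q`, and the extra `1` allows for the right neighbour of the last cell.
  have hfin : ∀ᶠ x in crossingFilter C κ r₀, ∀ j ∈ Set.Iic (2 * k * T + 1),
      |x.1 (j * (x.2 / k)) - Real.exp (-(j / k : ℝ))| ≤ ε / 2 := by
    rw [eventually_all_finite (Set.finite_Iic _)]
    intro j _
    filter_upwards [Metric.tendsto_nhds.1 (tendsto_mul_div (C := C) (r₀ := r₀) hκ hk0 j) (ε / 2)
      (half_pos hε)] with x hx
    exact hx.le
  filter_upwards [eventually_crossingFilter, hfin, tendsto_snd_crossingFilter.eventually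
    (eventually_ge_atTop (k * (2 * k * T + 2)))] with x ⟨hx, _, _⟩ h1 h2 n hn
  obtain ⟨a, m⟩ := x
  dsimp only at *
  have hm0 : 0 < m := lt_of_lt_of_le (by positivity) h2
  have hm0' : (0 : ℝ) < m := by exact_mod_cast hm0
  set q := m / k with hq
  have hqk : k * q ≤ m := Nat.mul_div_le m k
  have hqk' : m < k * q + k := by
    have : k * q + m % k = m := Nat.div_add_mod m k
    have := Nat.mod_lt m hk0
    omega
  have hq2 : 2 * k * T + 2 ≤ q := (Nat.le_div_iff_mul_le hk0).2 (by rw [mul_comm]; exact h2)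
  have hq0 : 0 < q := by omega
  set j := n / q with hj
  have hj1 : j * q ≤ n := Nat.div_mul_le_self n q
  have hj2 : n < (j + 1) * q := by rw [mul_comm]; exact Nat.lt_mul_div_succ n hq0
  have hj3 : j ≤ 2 * k * T := by
    refine Nat.div_le_of_le_mul (hn.trans ?_)
    calc T * m ≤ T * (k * q + k * q) := by
          gcongr; nlinarith
      _ = q * (2 * k * T) := by ring
  have hjr1 : (j : ℝ) * q ≤ n := by exact_mod_cast hj1
  have hjr2 : (n : ℝ) ≤ (j + 1) * q := by exact_mod_cast hj2.le
  have hqr1 : (k : ℝ) * q ≤ m := by exact_mod_cast hqk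
  have hqr2 : (m : ℝ) ≤ k * q + k := by exact_mod_cast hqk'.le
  -- This keeps the rounding of `m / k`, accumulated over `j` cells, below one cell, so `n / m` lies
  -- between `(j - 1) / k` and `(j + 1) / k`.
  have hjr3 : (k : ℝ) * j ≤ m := by
    have : k * j ≤ m := le_trans (by gcongr; omega) hqk
    exact_mod_cast this
  have hnm1 : (n : ℝ) / m ≤ (j + 1) / k := by
    rw [div_le_div_iff₀ hm0' hk0']
    calc (n : ℝ) * k ≤ (j + 1) * q * k := by gcongr
      _ = (j + 1) * (k * q) := by ring
      _ ≤ (j + 1) * m := by gcongr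
  have hnm2 : (j - 1) / k ≤ (n : ℝ) / m := by
    rw [div_le_div_iff₀ hk0' hm0']
    have : (j : ℝ) * m ≤ j * (k * q + k) := by gcongr
    have : (j : ℝ) * q * k ≤ n * k := by gcongr
    nlinarith
  have b1 := abs_le.1 (h1 j (by simp only [Set.mem_Iic]; omega))
  have b2 := abs_le.1 (h1 (j + 1) (by simp only [Set.mem_Iic]; omega))
  have a1 := hx.antitone hj1
  have a2 := hx.antitone hj2.le
  have hnm0 : 0 ≤ (n : ℝ) / m := by positivity
  have e1 := abs_le.1 (abs_exp_neg_sub_exp_neg_le (x := j / k) (by positivity) hnm0)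
  have e2 := abs_le.1 (abs_exp_neg_sub_exp_neg_le (x := (j + 1) / k) (by positivity) hnm0)
  have s1 : |(j / k : ℝ) - n / m| ≤ 2 / k := by
    rw [add_div] at hnm1; rw [sub_div] at hnm2
    have : (2 : ℝ) / k = 1 / k + 1 / k := by ring
    have : (0 : ℝ) < 1 / k := by positivity
    rw [abs_le]; constructor <;> linarith
  have s2 : |((j + 1) / k : ℝ) - n / m| ≤ 2 / k := by
    rw [sub_div] at hnm2
    have : (2 : ℝ) / k = 1 / k + 1 / k := by ring
    have : (0 : ℝ) < 1 / k := by positivity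
    have : ((j : ℝ) + 1) / k = j / k + 1 / k := add_div _ _ _
    rw [abs_le]; constructor <;> linarith
  push_cast at b2
  rw [abs_le]; constructor <;> linarith

end Crossing

/-! ### The soft count and the map `x ↦ exp (-1 / x)`. -/

/-- A continuous substitute for the number of `n ≥ 1` with `a n > exp (-1)`. -/
noncomputable def softCount (a : ℕ → ℝ) : ℝ≥0∞ :=
  ∑' n : ℕ, ENNReal.ofReal (min 1 (n * (a n - Real.exp (-1))))

/-- The function `x ↦ exp (-1 / x)` on `[0, ∞]`. -/
noncomputable def expNegInv (x : ℝ≥0∞) : ℝ :=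
  (EReal.exp (-((x⁻¹ : ℝ≥0∞) : EReal))).toReal

lemma exp_neg_coe_ne_top (y : ℝ≥0∞) : EReal.exp (-(y : EReal)) ≠ ∞ := by
  rw [Ne, EReal.exp_eq_top_iff, EReal.neg_eq_top_iff]
  exact EReal.coe_ennreal_ne_bot y

lemma continuous_expNegInv : Continuous expNegInv := by
  have h : Continuous fun x : ℝ≥0∞ => EReal.exp (-((x⁻¹ : ℝ≥0∞) : EReal)) :=
    ENNReal.continuous_exp.comp (continuous_neg.comp
      (continuous_coe_ennreal_ereal.comp continuous_inv))
  exact continuous_iff_continuousAt.2 fun x =>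
    (ENNReal.tendsto_toReal (exp_neg_coe_ne_top _)).comp h.continuousAt

lemma expNegInv_mono : Monotone expNegInv := fun x y hxy => by
  refine ENNReal.toReal_mono (exp_neg_coe_ne_top _) (EReal.exp_monotone ?_)
  rw [EReal.neg_le_neg_iff, EReal.coe_ennreal_le_coe_ennreal_iff]
  exact ENNReal.inv_le_inv.2 hxy

lemma expNegInv_nonneg (x : ℝ≥0∞) : 0 ≤ expNegInv x := ENNReal.toReal_nonneg

@[simp] lemma expNegInv_zero : expNegInv 0 = 0 := by simp [expNegInv]

@[simp] lemma expNegInv_top : expNegInv ∞ = 1 := by simp [expNegInv]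

lemma expNegInv_ofReal {x : ℝ} (hx : 0 < x) :
    expNegInv (ENNReal.ofReal x) = Real.exp (-(1 / x)) := by
  rw [expNegInv, ← ENNReal.ofReal_inv_of_pos hx, EReal.coe_ennreal_ofReal,
    max_eq_left (inv_nonneg.2 hx.le), ← EReal.coe_neg, EReal.exp_coe,
    ENNReal.toReal_ofReal (Real.exp_pos _).le, one_div]

lemma softCount_term_eq_zero {a : ℕ → ℝ} {n : ℕ} (h : a n ≤ Real.exp (-1)) :
    ENNReal.ofReal (min 1 (n * (a n - Real.exp (-1)))) = 0 :=
  ENNReal.ofReal_eq_zero.2 ((min_le_right _ _).trans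
    (mul_nonpos_of_nonneg_of_nonpos n.cast_nonneg (sub_nonpos.2 h)))

lemma softCount_eq_sum {a : ℕ → ℝ} (ha : Antitone a) {m : ℕ} (h : a m ≤ Real.exp (-1)) :
    softCount a = ∑ n ∈ Finset.range m, ENNReal.ofReal (min 1 (n * (a n - Real.exp (-1)))) :=
  tsum_eq_sum fun n hn => softCount_term_eq_zero
    ((ha (by simpa using hn : m ≤ n)).trans h)

lemma softCount_le {a : ℕ → ℝ} (ha : Antitone a) {m : ℕ} (h : a (m + 1) ≤ Real.exp (-1)) :
    softCount a ≤ m := by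
  rw [softCount_eq_sum ha h, Finset.sum_range_succ']
  -- The term `n = 0` vanishes because of the weight `n`, so the bound is `m` and not `m + 1`.
  simp only [Nat.cast_zero, zero_mul, min_eq_right zero_le_one, ENNReal.ofReal_zero, add_zero]
  refine (Finset.sum_le_card_nsmul _ _ 1 fun n _ => ?_).trans (by simp)
  exact ENNReal.ofReal_le_one.2 (min_le_left _ _)

/-- The weight `n` saturates the cap: a margin `δ` over `exp (-1)` makes every term with `K < n ≤ p`
equal to `1`. -/
lemma le_softCount {a : ℕ → ℝ} (ha : Antitone a) {K p : ℕ} {δ : ℝ} (hδ : 0 ≤ δ) (hK : 1 ≤ K * δ)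
    (h : Real.exp (-1) + δ ≤ a p) : ((p - K : ℕ) : ℝ≥0∞) ≤ softCount a := by
  refine le_trans ?_ (ENNReal.sum_le_tsum (Finset.Ioc K p))
  rw [← Nat.card_Ioc, ← nsmul_one]
  refine Finset.card_nsmul_le_sum _ _ _ fun n hn => ?_
  rw [Finset.mem_Ioc] at hn
  rw [ENNReal.one_le_ofReal, le_min_iff]
  refine ⟨le_rfl, hK.trans ?_⟩
  have h1 := ha hn.2
  have h2 : (K : ℝ) ≤ n := by exact_mod_cast hn.1.le
  have h3 : δ ≤ a n - Real.exp (-1) := by linarith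
  gcongr

lemma exists_natCast_le_softCount (n : ℕ) : ∃ p : ℕ, ∀ a : ℕ → ℝ, Antitone a →
    (1 + Real.exp (-1)) / 2 ≤ a p → (n : ℝ≥0∞) ≤ softCount a := by
  have h1 : Real.exp (-1) < 1 := Real.exp_lt_one_iff.2 (by norm_num)
  have hδ : 0 < (1 - Real.exp (-1)) / 2 := by linarith
  obtain ⟨K, hK⟩ := exists_nat_ge (1 / ((1 - Real.exp (-1)) / 2))
  rw [div_le_iff₀ hδ] at hK
  refine ⟨n + K, fun a ha h => ?_⟩
  have := le_softCount ha (p := n + K) hδ.le hK (by linarith)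
  rwa [Nat.add_sub_cancel] at this

lemma softCount_eq_top {a : ℕ → ℝ} (ha : Antitone a) (h : ∀ p, (1 + Real.exp (-1)) / 2 ≤ a p) :
    softCount a = ∞ := by
  by_contra hne
  obtain ⟨n, hn⟩ := ENNReal.exists_nat_gt hne
  obtain ⟨p, hp⟩ := exists_natCast_le_softCount n
  exact absurd (hp a ha (h p)) (not_le.2 hn)

/-! ### Uniform comparison with a geometric sequence. -/

section Crossing

variable {C κ : ℝ} {r₀ : ℕ}

/-- The soft count is asymptotically the crossing place. -/
lemma eventually_le_softCount (hκ : 1 < κ) {ε : ℝ} (hε : 0 < ε) (hε1 : ε < 1) :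
    ∀ᶠ x in crossingFilter C κ r₀, ENNReal.ofReal ((1 - ε) * x.2) ≤ softCount x.1 := by
  -- Half the drop of the limit curve from time `1 - ε / 2` to time `1`: at `p ≈ (1 - ε / 2) * m` an
  -- approximation error `η` still leaves a margin `η`.
  set η := (Real.exp (-(1 - ε / 2)) - Real.exp (-1)) / 2 with hη
  have hη0 : 0 < η := by
    have : Real.exp (-1) < Real.exp (-(1 - ε / 2)) := Real.exp_lt_exp.2 (by linarith)
    linarith
  obtain ⟨K, hK⟩ := exists_nat_ge (1 / η)
  rw [div_le_iff₀ hη0] at hK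
  -- For `m ≥ m₀` the remaining `ε / 2 * m` absorbs the `K` lost terms and the floor.
  obtain ⟨m₀, hm₀⟩ := exists_nat_ge (2 * (K + 1) / ε)
  rw [div_le_iff₀ hε] at hm₀
  filter_upwards [eventually_crossingFilter, eventually_abs_sub_exp_le hκ 1 hη0,
    tendsto_snd_crossingFilter.eventually ((eventually_ge_atTop m₀).and (eventually_gt_atTop 0))]
    with x ⟨hx, _, _⟩ h1 ⟨h2, hm0⟩
  obtain ⟨a, m⟩ := x
  dsimp only at *
  have hm0' : (0 : ℝ) < m := by exact_mod_cast hm0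
  have h2' : (m₀ : ℝ) ≤ m := by exact_mod_cast h2
  set p := ⌊(1 - ε / 2) * m⌋₊ with hp
  have hp0 : 0 ≤ (1 - ε / 2) * m := mul_nonneg (by linarith) hm0'.le
  have hp1 : (p : ℝ) ≤ (1 - ε / 2) * m := Nat.floor_le hp0
  have hp2 : (1 - ε / 2) * m < p + 1 := Nat.lt_floor_add_one _
  have hpm : p ≤ 1 * m := by
    have : (p : ℝ) ≤ m := by nlinarith
    rw [one_mul]; exact_mod_cast this
  have h3 := abs_le.1 (h1 p hpm)
  have h4 : Real.exp (-(1 - ε / 2)) ≤ Real.exp (-(p / m : ℝ)) := by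
    refine Real.exp_le_exp.2 (neg_le_neg ?_)
    rwa [div_le_iff₀ hm0']
  have h5 : Real.exp (-1) + η ≤ a p := by linarith
  refine le_trans ?_ (le_softCount hx.antitone hη0.le hK h5)
  rw [← ENNReal.ofReal_natCast]
  refine ENNReal.ofReal_le_ofReal ?_
  have h6 : (p : ℝ) - K ≤ (p - K : ℕ) := by
    rw [sub_le_iff_le_add]; exact_mod_cast (by omega : p ≤ p - K + K)
  nlinarith

/-- A gap multiplicative sequence is close to the geometric sequence given by its soft count,
uniformly over all such sequences. -/
theorem exists_forall_abs_sub_expNegInv_pow_le (hκ : 1 < κ) {ε : ℝ} (hε : 0 < ε) :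
    ∃ N : ℕ, ∀ a, IsGapMultiplicative C κ r₀ a → ∀ n ≥ N,
      |a n - expNegInv (softCount a) ^ n| ≤ ε := by
  have hκ0 : 0 < κ := by linarith
  obtain ⟨δ, hδ0, hδ⟩ : ∃ δ : ℝ, 0 < δ ∧ δ < 1 ∧ δ / (1 - δ) ≤ ε / 2 := by
    refine ⟨ε / (2 + ε), by positivity, ?_, ?_⟩
    · rw [div_lt_one (by positivity)]; linarith
    · have : 1 - ε / (2 + ε) = 2 / (2 + ε) := by field_simp; ring
      rw [this, div_div_div_cancel_right₀ (by positivity)]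
  obtain ⟨hδ1, hδ2⟩ := hδ
  obtain ⟨T, hT⟩ := exists_nat_ge (Real.log (4 / ε))
  have hT' : Real.exp (-T) ≤ ε / 4 := by
    rw [Real.log_le_iff_le_exp (by positivity)] at hT
    rw [Real.exp_neg, inv_le_comm₀ (Real.exp_pos _) (by positivity), inv_div]
    exact hT
  obtain ⟨M', hM'⟩ := eventually_crossingFilter_iff.1
    ((eventually_abs_sub_exp_le (C := C) (r₀ := r₀) hκ T (show 0 < ε / 4 by positivity)).and
      (eventually_le_softCount hκ hδ0 hδ1))
  set M := M' + 1 with hM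
  obtain ⟨N₁, hN₁⟩ := IsGapMultiplicative.exists_forall_le hκ0 C r₀
    (Real.exp_lt_one_iff.2 (by norm_num : (-1 : ℝ) < 0)) M hε
  have hMr : (0 : ℝ) < M := by positivity
  obtain ⟨N₂, hN₂⟩ := exists_pow_lt_of_lt_one hε
    (Real.exp_lt_one_iff.2 (by simpa using hMr : -(1 / (M : ℝ)) < 0))
  refine ⟨max N₁ N₂, fun a ha n hn => ?_⟩
  -- Without a crossing, both sides equal `1`.
  by_cases hall : ∀ k, Real.exp (-1) < a k
  · have h1 := ha.eq_one_of_forall_lt hκ0 (Real.exp_pos _) hall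
    have h2 : softCount a = ∞ := by
      refine softCount_eq_top ha.antitone fun p => ?_
      rw [h1]
      linarith [Real.exp_lt_one_iff.2 (by norm_num : (-1 : ℝ) < 0)]
    rw [h1, h2, expNegInv_top, one_pow, sub_self, abs_zero]
    exact hε.le
  push Not at hall
  classical
  have hk0 : Nat.find hall ≠ 0 := fun h => by
    have := Nat.find_spec hall
    rw [h, ha.zero] at this
    exact absurd (Real.exp_lt_one_iff.2 (by norm_num : (-1 : ℝ) < 0)) (not_lt.2 this)
  obtain ⟨m, hm⟩ := Nat.exists_eq_succ_of_ne_zero hk0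
  have hm1 : a (m + 1) ≤ Real.exp (-1) := by
    have := Nat.find_spec hall
    rwa [hm] at this
  have hm2 : Real.exp (-1) < a m := not_le.1 (Nat.find_min hall (by omega))
  have hup := softCount_le ha.antitone hm1
  -- For an early crossing both quantities are at most `ε`, by uniform geometric decay. For a late
  -- one both are compared with `exp (-n / m)`.
  rcases lt_or_ge m M with hmM | hmM
  · have h1 := hN₁ a ha ((ha.antitone hmM).trans hm1) n (le_of_max_le_left hn)
    have h2 : expNegInv (softCount a) ≤ Real.exp (-(1 / (M : ℝ))) := by
      rw [← expNegInv_ofReal hMr, ENNReal.ofReal_natCast]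
      exact expNegInv_mono (hup.trans (by exact_mod_cast hmM.le))
    have h3 : expNegInv (softCount a) ^ n ≤ ε :=
      (pow_le_pow_left₀ (expNegInv_nonneg _) h2 n).trans
        ((pow_le_pow_of_le_one (Real.exp_pos _).le (Real.exp_le_one_iff.2
          (by simp)) (le_of_max_le_right hn)).trans hN₂.le)
    exact abs_sub_le_of_nonneg_of_le (ha.nonneg n) h1 (pow_nonneg (expNegInv_nonneg _) n) h3
  · obtain ⟨h1, h2⟩ := hM' m (by omega) a ha hm1 hm2
    dsimp only at h1 h2
    have hm0 : (0 : ℝ) < m := by exact_mod_cast (by omega : 0 < m)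
    have h1δ : 0 < 1 - δ := by linarith
    obtain ⟨x, hx⟩ : ∃ x : ℝ, softCount a = ENNReal.ofReal x :=
      ⟨_, (ENNReal.ofReal_toReal (ne_top_of_le_ne_top (ENNReal.natCast_ne_top m) hup)).symm⟩
    have hx1 : (1 - δ) * m ≤ x := by
      rw [hx] at h2
      exact (ENNReal.ofReal_le_ofReal_iff'.1 h2).resolve_right (by
        rw [not_le]; positivity)
    have hx0 : 0 < x := lt_of_lt_of_le (by positivity) hx1
    have hx2 : x ≤ m := by
      rw [hx, ← ENNReal.ofReal_natCast, ENNReal.ofReal_le_ofReal_iff hm0.le] at hup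
      exact hup
    rw [hx, expNegInv_ofReal hx0, ← Real.exp_nat_mul]
    have h3 : |Real.exp (-(n / m : ℝ)) - Real.exp (n * -(1 / x))| ≤ ε / 2 := by
      have e : (n : ℝ) * -(1 / x) = -(n / m * (1 + (m / x - 1))) := by
        field_simp; ring
      rw [e]
      refine (abs_exp_neg_sub_exp_neg_mul_le (by positivity) ?_).trans (le_trans ?_ hδ2)
      · rw [sub_nonneg, one_le_div hx0]; exact hx2
      · rw [sub_le_iff_le_add, div_add_one h1δ.ne', add_sub_cancel, div_le_div_iff₀ hx0 h1δ]
        linarith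
    have h4 : |a n - Real.exp (-(n / m : ℝ))| ≤ ε / 2 := by
      -- Beyond `T * m`, monotonicity suffices, as both terms are already small at `T * m`.
      rcases le_total n (T * m) with hnT | hnT
      · exact (h1 n hnT).trans (by linarith)
      · have h5 := (abs_le.1 (h1 (T * m) le_rfl)).2
        have h6 := ha.antitone hnT
        have h7 : ((T * m : ℕ) : ℝ) / m = T := by push_cast; field_simp
        rw [h7] at h5
        have h8 : Real.exp (-(n / m : ℝ)) ≤ Real.exp (-T) := by
          refine Real.exp_le_exp.2 (neg_le_neg ?_)
          rw [le_div_iff₀ hm0]; exact_mod_cast hnT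
        exact abs_sub_le_of_nonneg_of_le (ha.nonneg n) (by linarith) (Real.exp_pos _).le
          (by linarith)
    exact (abs_sub_le _ _ _).trans ((add_le_add h4 h3).trans (add_halves ε).le)

end Crossing

/-! ### Continuity of the soft count in the level. -/

section Continuity

variable {D : ℕ → ℝ → ℝ} {C κ : ℝ} {r₀ : ℕ}

lemma softCount_mono {a a' : ℕ → ℝ} (h : ∀ n, a n ≤ a' n) : softCount a ≤ softCount a' :=
  ENNReal.tsum_le_tsum fun n => ENNReal.ofReal_le_ofReal (min_le_min_left _
    (mul_le_mul_of_nonneg_left (sub_le_sub_right (h n) _) n.cast_nonneg))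

/-- The soft count depends continuously on the level. -/
lemma continuous_softCount (hκ : 0 < κ) (hD : ∀ n, Continuous (D n))
    (hgap : ∀ u, IsGapMultiplicative C κ r₀ fun n => D n u) :
    Continuous fun u => softCount fun n => D n u := by
  have hterm : ∀ n : ℕ, Continuous fun u =>
      ENNReal.ofReal (min 1 (n * (D n u - Real.exp (-1)))) := fun n =>
    ENNReal.continuous_ofReal.comp (continuous_const.min
      (continuous_const.mul ((hD n).sub continuous_const)))
  rw [continuous_iff_continuousAt]
  intro u
  by_cases hall : ∀ k, Real.exp (-1) < D k u
  · have hone := (hgap u).eq_one_of_forall_lt hκ (Real.exp_pos _) hall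
    have hlt : (1 + Real.exp (-1)) / 2 < 1 := by
      linarith [Real.exp_lt_one_iff.2 (by norm_num : (-1 : ℝ) < 0)]
    rw [ContinuousAt, softCount_eq_top (hgap u).antitone fun p => by rw [hone]; exact hlt.le,
      ENNReal.tendsto_nhds_top_iff_nat]
    intro n
    obtain ⟨p, hp⟩ := exists_natCast_le_softCount (n + 1)
    have h1 : (1 + Real.exp (-1)) / 2 < D p u := by rw [hone p]; exact hlt
    filter_upwards [(hD p).continuousAt.eventually (lt_mem_nhds h1)] with v hv
    exact lt_of_lt_of_le (by exact_mod_cast n.lt_succ_self) (hp _ (hgap v).antitone hv.le)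
  · push Not at hall
    obtain ⟨M, hM⟩ := hall
    -- Decay supplies a place with strict inequality `D N u < exp (-1)`. It persists near `u`, where
    -- the series is therefore a finite sum with a fixed range.
    obtain ⟨N, hN⟩ := IsGapMultiplicative.exists_forall_le hκ C r₀
      (Real.exp_lt_one_iff.2 (by norm_num : (-1 : ℝ) < 0)) M (half_pos (Real.exp_pos (-1)))
    have h1 : D N u < Real.exp (-1) :=
      (hN _ (hgap u) hM N le_rfl).trans_lt (half_lt_self (Real.exp_pos _))
    have h2 : (fun v => softCount fun n => D n v) =ᶠ[𝓝 u] fun v =>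
        ∑ n ∈ Finset.range N, ENNReal.ofReal (min 1 (n * (D n v - Real.exp (-1)))) := by
      filter_upwards [(hD N).continuousAt.eventually (gt_mem_nhds h1)] with v hv
      exact softCount_eq_sum (hgap v).antitone hv.le
    exact (continuous_finsetSum _ fun n _ => hterm n).continuousAt.congr h2.symm

end Continuity

end Phantom

/-! ### Construction of the phantom distribution function. -/

theorem mainTheorem7 {Ω : Type*} [MeasurableSpace Ω] (P : Measure Ω) [IsProbabilityMeasure P]
    (X : ℕ → Ω → ℝ) (hX : ∀ j, Measurable (X j))
    (hstat : Phantom.IsStationary P X)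
    (hcont : Continuous (Phantom.marginalDF P X))
    (b B : ℝ) (hb : 0 < b) (hB : 0 < B)
    (hconc : ∀ x u : ℝ, 0 < u →
      Phantom.marginalDF P X (x + u) - Phantom.marginalDF P X x ≤ B * u ^ b)
    (hdep : Phantom.IsThetaWeaklyDependent P X)
    (β : ℝ) (hβ : (1 + √5) / 2 * (1 + 1 / b) < β)
    -- The values `θ(r)` are finite for all large `r`, by the preceding hypothesis.
    (hrate : (fun r : ℕ => (Phantom.thetaCoeff P X r).toReal) =O[atTop]
      fun r : ℕ => (r : ℝ) ^ (-β)) :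
    ∃ G : ℝ → ℝ, Continuous G ∧ Phantom.IsPhantomDF P X G := by
  obtain ⟨C, r₀, hgap⟩ :=
    Phantom.exists_isGapMultiplicative_maxDF hX hstat hb hB hconc hdep hrate
  have hκ : 1 < β * b / (1 + b) := by
    rw [one_lt_div (by linarith)]
    have h1 : 1 ≤ (1 + √5) / 2 := by
      have : 1 ≤ √5 := Real.one_le_sqrt.2 (by norm_num)
      linarith
    have h2 : 1 + 1 / b < β :=
      (le_mul_of_one_le_left (by positivity) h1).trans_lt hβ
    calc 1 + b = (1 + 1 / b) * b := by field_simp; ring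
      _ < β * b := by gcongr
  have hD := Phantom.continuous_maxDF hX hstat hcont
  have hF : (fun u => Phantom.maxDF P X 1 u) = cdf (P.map (X 0)) := by
    funext u
    have := Measure.isProbabilityMeasure_map (μ := P) (hX 0).aemeasurable
    rw [Phantom.maxDF_one, cdf_eq_real, map_measureReal_apply (hX 0) measurableSet_Iic]
    rfl
  have hbot : Tendsto (Phantom.maxDF P X 1) atBot (𝓝 0) := by
    rw [show Phantom.maxDF P X 1 = _ from hF]; exact tendsto_cdf_atBot _
  have htop : Tendsto (Phantom.maxDF P X 1) atTop (𝓝 1) := by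
    rw [show Phantom.maxDF P X 1 = _ from hF]; exact tendsto_cdf_atTop _
  set N : ℝ → ℝ≥0∞ := fun u => Phantom.softCount fun n => Phantom.maxDF P X n u with hN
  have hNcont : Continuous N := Phantom.continuous_softCount (by linarith) hD hgap
  have hG : Continuous fun u => Phantom.expNegInv (N u) := Phantom.continuous_expNegInv.comp hNcont
  have hNbot : Tendsto N atBot (𝓝 0) := by
    refine tendsto_const_nhds.congr' ?_
    filter_upwards [hbot.eventually (ge_mem_nhds (Real.exp_pos (-1)))] with u hu
    exact (nonpos_iff_eq_zero.1
      (by simpa using Phantom.softCount_le (hgap u).antitone (m := 0) hu)).symm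
  have hNtop : Tendsto N atTop (𝓝 ∞) := by
    rw [ENNReal.tendsto_nhds_top_iff_nat]
    intro n
    obtain ⟨p, hp⟩ := Phantom.exists_natCast_le_softCount (n + 1)
    have h1 : Tendsto (Phantom.maxDF P X p) atTop (𝓝 1) := by
      -- The union bound transfers the limit at `+∞` from the marginal to each fixed `p`.
      have h2 : ∀ u, 1 - p * (1 - Phantom.maxDF P X 1 u) ≤ Phantom.maxDF P X p u := by
        intro u
        clear hp
        induction p with
        | zero => simp [Phantom.maxDF_zero]
        | succ p ih =>
          have := (hgap u).sub_le p 1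
          push_cast
          linarith
      refine tendsto_of_tendsto_of_tendsto_of_le_of_le ?_ tendsto_const_nhds h2
        fun u => (hgap u).le_one p
      simpa using (((htop.const_sub 1).const_mul (p : ℝ)).const_sub 1)
    have h2 : (1 + Real.exp (-1)) / 2 < 1 := by
      have := Real.exp_lt_one_iff.2 (by norm_num : (-1 : ℝ) < 0)
      linarith
    filter_upwards [h1.eventually (lt_mem_nhds h2)] with v hv
    exact lt_of_lt_of_le (by exact_mod_cast n.lt_succ_self) (hp _ (hgap v).antitone hv.le)
  refine ⟨fun u => Phantom.expNegInv (N u), hG, ⟨fun u v huv => ?_, fun x =>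
    hG.continuousWithinAt, ?_, ?_⟩, ?_⟩
  · exact Phantom.expNegInv_mono (Phantom.softCount_mono fun n => Phantom.maxDF_mono n huv)
  · simpa [Function.comp_def] using (Phantom.continuous_expNegInv.tendsto 0).comp hNbot
  · simpa [Function.comp_def] using (Phantom.continuous_expNegInv.tendsto ∞).comp hNtop
  · rw [Metric.tendsto_atTop]
    intro ε hε
    obtain ⟨n₀, hn₀⟩ := Phantom.exists_forall_abs_sub_expNegInv_pow_le (C := C) (r₀ := r₀) hκ
      (half_pos hε)
    -- `n = 0` is excluded because `partialMax` is then a supremum over an empty index set.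
    refine ⟨max n₀ 1, fun n hn => ?_⟩
    have hn1 : 0 < n := le_of_max_le_right hn
    rw [Real.dist_eq, sub_zero, abs_of_nonneg (Real.iSup_nonneg fun _ => abs_nonneg _)]
    refine (ciSup_le fun u => ?_).trans_lt (half_lt_self hε)
    have : {ω | Phantom.partialMax X n ω ≤ u} = Phantom.noExceed X 0 n u :=
      Set.ext fun ω => Phantom.partialMax_le_iff hn1 u ω
    rw [this]
    exact hn₀ _ (hgap u) n (le_of_max_le_left hn)
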